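/- For nonnegative integers $N$ and $K$ let $S(N,K)$ denote the Stirling number of the second kind, i.e. the number of ways to partition a set of $N$ elements into exactly $K$ non-empty subsets. Let $\nu_2(k)$ denote the $2$-adic valuation of a positive integer $k$, and let $s_2(k)$ denote the sum of the binary digits of $k$. Let $a,b,c,m,n$ be positive integers with $1\le a<2^{n+1}$, with $c$ odd, and with $m\ge n+2+\lfloor\log_2 b\rfloor$. Then $S(c2^m+b2^{n+1}+2^n,\;b2^{n+2}+a)$ is nonzero and $$ \nu_2\bigl(S(c2^m+b2^{n+1}+2^n,\;b2^{n+2}+a)\bigr) \begin{cases} = n, & \text{if } a=2^{n+1}-1,\\ \ge s_2(a), & \text{if } a<2^{n+1}-1. \end{cases} $$ -/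

import Mathlib

/-- `s₂ a`: the sum of the binary digits of the natural number `a`. -/
def s₂ (a : ℕ) : ℕ := (Nat.digits 2 a).sum

open Polynomial
open scoped fwdDiff Nat

/-! Let L_a be the functional on ℤ[X] with L_a(X^N) = S(N,a), so that a!·L_a(p) = Δ^a p(0). Put M =
c·2^m, expand X^M = ((X-1)+1)^M, and write S = Σ C(M,k)·l_k with l_k =
L_{b2^(n+2)+a}(X^(b2^(n+1)+2^n)(X-1)^k). Modulo powers of 2 a long falling factorial is a power of
X^2-X, which lowers the index of L (`two_pow_dvd_stirlingLin_sub`).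

Let t = L_a(X^(2^n)(X-1)^(2^(n+1))). For k > 0, the divisibility of C(M,k) allows l_k to be replaced
by t modulo 2^(s₂ a) (`two_pow_dvd_choose_mul_stirlingLin_sub`). Since l_0 = 0, Σ C(M,k) = 2^M and
2t ≡ 0, this gives S ≡ -t.

As v₂(a!) = a - s₂ a, the question becomes whether 2^a divides Δ^a of y^(2^n)(y-1)^(2^(n+1)) at 0.
Modulo 2^(2^(n+1)) this function lives on y ≡ 2 mod 4, where it is 2^(2^n) times an odd number close
enough to 1 to be replaced by 1. The differences of that indicator have explicit 2-adic bounds,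
which fall short, by exactly one factor 2, only at a = 2^(n+1)-1 (`two_pow_dvd_stirlingLin_iff_ne`).
-/

/-- `DiffDvd q c d f`: on `{0, …, d - 1}`, every `j`-th forward difference of `f` is divisible
by `c * q ^ j`. -/
def DiffDvd (q c : ℤ) (d : ℕ) (f : ℕ → ℤ) : Prop :=
  ∀ j x, x + j < d → c * q ^ j ∣ (fwdDiff 1)^[j] f x

/-! ### Calculus of divisibility of forward differences -/

namespace DiffDvd

variable {q c c' : ℤ} {d : ℕ} {f g : ℕ → ℤ}

theorem apply_dvd (hf : DiffDvd q c d f) {x : ℕ} (hx : x < d) : c ∣ f x := by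
  simpa using hf 0 x (by simpa using hx)

theorem of_dvd (h : c' ∣ c) (hf : DiffDvd q c d f) : DiffDvd q c' d f :=
  fun j x hx => (mul_dvd_mul_right h _).trans (hf j x hx)

theorem of_le {e : ℕ} (h : e ≤ d) (hf : DiffDvd q c d f) : DiffDvd q c e f :=
  fun j x hx => hf j x (hx.trans_le h)

theorem add (hf : DiffDvd q c d f) (hg : DiffDvd q c d g) : DiffDvd q c d (f + g) := by
  intro j x hx
  rw [fwdDiff_iter_add]
  exact dvd_add (hf j x hx) (hg j x hx)

theorem const_smul (k : ℤ) (hf : DiffDvd q c d f) : DiffDvd q (k * c) d (k • f) := by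
  intro j x hx
  rw [fwdDiff_iter_const_smul, Pi.smul_apply, smul_eq_mul, mul_assoc]
  exact mul_dvd_mul_left _ (hf j x hx)

theorem of_const_smul {k : ℤ} (hk : k ≠ 0) (hf : DiffDvd q (k * c) d (k • f)) :
    DiffDvd q c d f := by
  intro j x hx
  have := hf j x hx
  rw [fwdDiff_iter_const_smul, Pi.smul_apply, smul_eq_mul, mul_assoc] at this
  exact (mul_dvd_mul_iff_left hk).1 this

theorem diff (hf : DiffDvd q c (d + 1) f) : DiffDvd q (c * q) d (Δ_[1] f) := by
  intro j x hx
  have := hf (j + 1) x (by omega)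
  rwa [Function.iterate_succ_apply, pow_succ', ← mul_assoc] at this

theorem of_diff (h0 : ∀ x < d + 1, c ∣ f x) (hf : DiffDvd q (c * q) d (Δ_[1] f)) :
    DiffDvd q c (d + 1) f := by
  rintro (_ | j) x hx
  · simpa using h0 x (by simpa using hx)
  · rw [Function.iterate_succ_apply, pow_succ', ← mul_assoc]
    exact hf j x (by omega)

theorem of_forall_dvd (h : ∀ x < d, c ∣ f x) : DiffDvd 1 c d f := by
  intro j
  rw [one_pow, mul_one]
  induction j generalizing f d with
  | zero => intro x hx; simpa using h x (by simpa using hx)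
  | succ j ih =>
    intro x hx
    rw [Function.iterate_succ_apply]
    refine ih (d := d - 1) (fun y hy => ?_) x (by omega)
    exact dvd_sub (h (y + 1) (by omega)) (h y (by omega))

theorem const {k : ℤ} (hk : c ∣ k) : DiffDvd q c d fun _ => k := by
  rintro (_ | j) x -
  · simpa using hk
  · have : (fwdDiff 1)^[j] (fun _ : ℕ => (0 : ℤ)) = 0 := by
      induction j with
      | zero => rfl
      | succ j ih => rw [Function.iterate_succ_apply', ih]; ext; simp [fwdDiff]
    rw [Function.iterate_succ_apply, fwdDiff_const, this]
    exact dvd_zero _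

theorem _root_.fwdDiff_mul_int (f g : ℕ → ℤ) :
    Δ_[1] (f * g) = Δ_[1] f * g + f * Δ_[1] g + Δ_[1] f * Δ_[1] g := by
  ext x; simp [fwdDiff]; ring

/-- Induction on the order of the difference through the discrete Leibniz rule; the extra term Δf·Δg
even gains a spare factor q. -/
theorem mul (hf : DiffDvd q c d f) (hg : DiffDvd q c' d g) : DiffDvd q (c * c') d (f * g) := by
  intro j
  induction j generalizing d c c' f g with
  | zero =>
    intro x hx
    simpa using mul_dvd_mul (hf.apply_dvd (by simpa using hx)) (hg.apply_dvd (by simpa using hx))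
  | succ j ih =>
    intro x hx
    obtain ⟨d, rfl⟩ : ∃ e, d = e + 1 := ⟨d - 1, by omega⟩
    have hx' : x + j < d := by omega
    rw [Function.iterate_succ_apply, fwdDiff_mul_int, fwdDiff_iter_add, fwdDiff_iter_add]
    refine dvd_add (dvd_add ?_ ?_) ?_
    · have := ih hf.diff (hg.of_le d.le_succ) x hx'
      exact (dvd_of_eq (by ring)).trans this
    · have := ih (hf.of_le d.le_succ) hg.diff x hx'
      exact (dvd_of_eq (by ring)).trans this
    · have := ih hf.diff hg.diff x hx'
      exact (Dvd.intro q (by ring)).trans this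

theorem mul_sub_one (hf : DiffDvd q c d (f - 1)) (hg : DiffDvd q c d (g - 1)) :
    DiffDvd q c d (f * g - 1) := by
  have : f * g - 1 = (f - 1) * (g - 1) + (f - 1) + (g - 1) := by ring
  rw [this]
  exact (((hf.mul hg).of_dvd (Dvd.intro _ rfl)).add hf).add hg

theorem pow_sub_one (hf : DiffDvd q c d (f - 1)) (k : ℕ) : DiffDvd q c d (f ^ k - 1) := by
  induction k with
  | zero => rw [pow_zero, sub_self]; exact const (k := 0) (dvd_zero c)
  | succ k ih => rw [pow_succ]; exact ih.mul_sub_one hf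

/-- Squaring costs no further factor 2, because Δ(2f²) = 2(2f·Δf + (Δf)²) and Δf inherits the bound
of 2f after cancelling a 2. -/
theorem two_smul_sq (hf : DiffDvd 2 1 d ((2 : ℤ) • f)) : DiffDvd 2 1 d ((2 : ℤ) • (f ^ 2)) := by
  cases d with
  | zero => intro j x hx; omega
  | succ d =>
    have hd : DiffDvd 2 1 d (Δ_[1] f) := by
      have := hf.diff
      rw [fwdDiff_const_smul, mul_comm] at this
      exact this.of_const_smul two_ne_zero
    refine of_diff (fun _ _ => one_dvd _) ?_
    have : Δ_[1] ((2 : ℤ) • f ^ 2)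
        = (2 : ℤ) • (((2 : ℤ) • f) * Δ_[1] f + Δ_[1] f * Δ_[1] f) := by
      rw [fwdDiff_const_smul, sq, fwdDiff_mul_int]
      ext x; simp; ring
    rw [this, mul_comm]
    simpa using ((((hf.of_le d.le_succ).mul hd).add (hd.mul hd)).const_smul 2)

end DiffDvd

/-! ### Binary digit sums, powers, factorials and binomial coefficients -/

theorem s₂_two_mul (r : ℕ) : s₂ (2 * r) = s₂ r := by
  rcases Nat.eq_zero_or_pos r with rfl | hr
  · rfl
  · unfold s₂
    rw [Nat.digits_def' (by norm_num) (by omega)]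
    simp

theorem s₂_two_mul_add_one (r : ℕ) : s₂ (2 * r + 1) = s₂ r + 1 := by
  unfold s₂
  rw [Nat.digits_def' (by norm_num) (by omega), List.sum_cons, add_comm]
  congr 3 <;> omega

theorem s₂_le_of_lt {n r : ℕ} (h : r < 2 ^ n) : s₂ r ≤ n := by
  induction n generalizing r with
  | zero => simp at h; simp [h, s₂]
  | succ n ih =>
    obtain ⟨k, rfl | rfl⟩ := Nat.even_or_odd' r
    · rw [s₂_two_mul]; exact (ih (by omega)).trans n.le_succ
    · rw [s₂_two_mul_add_one]; exact Nat.succ_le_succ (ih (by omega))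

theorem s₂_pos {r : ℕ} (h : 0 < r) : 0 < s₂ r := by
  induction r using Nat.strong_induction_on with
  | _ r ih =>
    obtain ⟨k, rfl | rfl⟩ := Nat.even_or_odd' r
    · rw [s₂_two_mul]; exact ih k (by omega) (by omega)
    · rw [s₂_two_mul_add_one]; omega

theorem s₂_two_pow_sub_one (n : ℕ) : s₂ (2 ^ n - 1) = n := by
  induction n with
  | zero => simp [s₂]
  | succ n ih =>
    have : 2 ^ (n + 1) - 1 = 2 * (2 ^ n - 1) + 1 := by have := Nat.one_le_two_pow (n := n); omega
    rw [this, s₂_two_mul_add_one, ih]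

theorem s₂_two_pow_add {k a : ℕ} (h : a < 2 ^ k) : s₂ (2 ^ k + a) = s₂ a + 1 := by
  induction k generalizing a with
  | zero => simp at h; simp [h, s₂]
  | succ k ih =>
    obtain ⟨r, rfl | rfl⟩ := Nat.even_or_odd' a
    · rw [pow_succ', ← mul_add, s₂_two_mul, s₂_two_mul, ih (by omega)]
    · rw [pow_succ', ← add_assoc, ← mul_add, s₂_two_mul_add_one, s₂_two_mul_add_one,
        ih (by omega)]

theorem s₂_add_padicValNat_le {n r : ℕ} (h0 : 0 < r) (h : r < 2 ^ n) :
    s₂ r + padicValNat 2 r ≤ n := by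
  induction n generalizing r with
  | zero => simp at h; omega
  | succ n ih =>
    obtain ⟨k, rfl | rfl⟩ := Nat.even_or_odd' r
    · rw [s₂_two_mul, padicValNat.mul (by norm_num) (by omega), padicValNat.self (by norm_num)]
      have := ih (r := k) (by omega) (by omega)
      omega
    · rw [padicValNat.eq_zero_of_not_dvd (by omega)]
      exact s₂_le_of_lt h

/-- Binary exponentiation: squarings are free, and each digit 1 of r costs one factor 2. -/
theorem DiffDvd.pow_of_two_smul {d : ℕ} {h : ℕ → ℤ} (hh : DiffDvd 2 1 d ((2 : ℤ) • h)) (r : ℕ) :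
    DiffDvd 2 1 d ((2 ^ s₂ r : ℤ) • h ^ r) := by
  induction r using Nat.strong_induction_on generalizing h with
  | _ r ih =>
    rcases Nat.eq_zero_or_pos r with rfl | hr
    · have : DiffDvd 2 1 d 1 := DiffDvd.const (k := 1) (one_dvd _)
      simpa [s₂] using this
    obtain ⟨k, rfl | rfl⟩ := Nat.even_or_odd' r
    · rw [s₂_two_mul, pow_mul]
      exact ih k (by omega) hh.two_smul_sq
    · have := (ih k (by omega) hh.two_smul_sq).mul hh
      rw [s₂_two_mul_add_one, pow_succ h, pow_mul, pow_succ (2 : ℤ)]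
      rwa [smul_mul_smul_comm, mul_one] at this

theorem DiffDvd.two_smul_pow_two_pow {d : ℕ} {h : ℕ → ℤ} (hh : DiffDvd 2 1 d ((2 : ℤ) • h))
    (n : ℕ) : DiffDvd 2 1 d ((2 : ℤ) • h ^ 2 ^ n) := by
  induction n with
  | zero => simpa using hh
  | succ n ih => rw [pow_succ, pow_mul]; exact ih.two_smul_sq

theorem diffDvd_two_smul_sub_const (d : ℕ) (k : ℤ) :
    DiffDvd 2 1 d ((2 : ℤ) • fun x : ℕ => (x : ℤ) - k) := by
  cases d with
  | zero => intro j x hx; omega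
  | succ d =>
    refine DiffDvd.of_diff (fun _ _ => one_dvd _) ?_
    have : Δ_[1] ((2 : ℤ) • fun x : ℕ => (x : ℤ) - k) = fun _ => 2 := by
      ext x; simp [fwdDiff]; ring
    rw [this]
    exact DiffDvd.const (by norm_num)

/-- Since `v₂(a!) = a - s₂ a`, dividing by `a!` turns divisibility by `2 ^ a` into divisibility
by `2 ^ s₂ a`. -/
theorem two_pow_dvd_factorial_mul_iff (a : ℕ) (z : ℤ) :
    (2 : ℤ) ^ a ∣ (a ! : ℤ) * z ↔ (2 : ℤ) ^ s₂ a ∣ z := by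
  have h1 : padicValNat 2 a ! = a - s₂ a := by
    have := sub_one_mul_padicValNat_factorial (p := 2) a
    simpa [s₂] using this
  have h2 : s₂ a ≤ a := Nat.digit_sum_le 2 a
  obtain ⟨u, hu⟩ : 2 ^ padicValNat 2 a ! ∣ a ! := pow_padicValNat_dvd
  have hodd : ¬ 2 ∣ u := by
    rintro ⟨w, rfl⟩
    refine pow_succ_padicValNat_not_dvd (p := 2) (Nat.factorial_ne_zero a) ⟨w, ?_⟩
    rw [pow_succ, mul_assoc]; exact hu
  have hco : IsCoprime ((2 : ℤ) ^ s₂ a) (u : ℤ) := by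
    refine IsCoprime.pow_left ?_
    exact_mod_cast Nat.isCoprime_iff_coprime.2 ((Nat.prime_two.coprime_iff_not_dvd).2 hodd)
  rw [hu, h1]
  have : (2 : ℤ) ^ a = 2 ^ (a - s₂ a) * 2 ^ s₂ a := by rw [← pow_add]; congr 1; omega
  rw [this]; push_cast
  rw [mul_assoc, mul_dvd_mul_iff_left (by positivity)]
  exact ⟨fun h => hco.dvd_of_dvd_mul_left h, fun h => h.mul_left _⟩

/-- From k·C(M,k) = M·C(M-1,k-1) one gets at least m - v₂(r) factors 2, and s₂ r + v₂(r) ≤ n for 0 <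
r < 2^n. -/
theorem two_pow_dvd_choose {m n r : ℕ} (c q : ℕ) (hr0 : 0 < r) (hr : r < 2 ^ n) (hnm : n ≤ m) :
    2 ^ (m - n + s₂ r) ∣ (c * 2 ^ m).choose (2 ^ n * q + r) := by
  set v := padicValNat 2 r with hv
  have hle : s₂ r + v ≤ n := s₂_add_padicValNat_le hr0 hr
  obtain ⟨u, hu⟩ : 2 ^ v ∣ r := pow_padicValNat_dvd
  have hodd : ¬ 2 ∣ u := by
    rintro ⟨w, rfl⟩
    refine pow_succ_padicValNat_not_dvd (p := 2) hr0.ne' ⟨w, ?_⟩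
    rw [pow_succ, mul_assoc]; exact hu
  have hs : 0 < s₂ r := s₂_pos hr0
  have hn : (2 : ℕ) ^ n = 2 ^ v * (2 * 2 ^ (n - v - 1)) := by
    rw [← pow_succ', ← pow_add]; congr 1; omega
  have hk : 2 ^ n * q + r = 2 ^ v * (2 * (2 ^ (n - v - 1) * q) + u) := by
    rw [hn]; linear_combination hu
  have hm : c * 2 ^ m = 2 ^ v * (2 ^ (m - v) * c) := by
    rw [← mul_assoc, ← pow_add, mul_comm]; congr 2; omega
  refine (pow_dvd_pow 2 (show m - n + s₂ r ≤ m - v by omega)).trans ?_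
  have key : (2 ^ n * q + r) * (c * 2 ^ m).choose (2 ^ n * q + r)
      = (c * 2 ^ m) * (c * 2 ^ m - 1).choose (2 ^ n * q + r - 1) := by
    rcases Nat.eq_zero_or_pos c with rfl | hc
    · rw [Nat.choose_eq_zero_of_lt (by omega)]; simp
    · have h1 : 0 < c * 2 ^ m := by positivity
      have := Nat.add_one_mul_choose_eq (c * 2 ^ m - 1) (2 ^ n * q + r - 1)
      rw [Nat.sub_add_cancel h1, Nat.sub_add_cancel (by omega)] at this
      rw [this, mul_comm]
  rw [show (2 ^ n * q + r) * (c * 2 ^ m).choose (2 ^ n * q + r)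
      = 2 ^ v * ((2 * (2 ^ (n - v - 1) * q) + u) * (c * 2 ^ m).choose (2 ^ n * q + r)) by
        nth_rewrite 1 [hk]; ring,
    show (c * 2 ^ m) * (c * 2 ^ m - 1).choose (2 ^ n * q + r - 1)
      = 2 ^ v * (2 ^ (m - v) * (c * (c * 2 ^ m - 1).choose (2 ^ n * q + r - 1))) by
        nth_rewrite 1 [hm]; ring] at key
  have key' := Nat.eq_of_mul_eq_mul_left (by positivity) key
  have hco : Nat.Coprime (2 ^ (m - v)) (2 * (2 ^ (n - v - 1) * q) + u) := by
    refine Nat.Coprime.pow_left _ (Nat.prime_two.coprime_iff_not_dvd.2 fun h => hodd ?_)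
    exact (Nat.dvd_add_right (Dvd.intro _ rfl)).1 h
  exact hco.dvd_of_dvd_mul_left ⟨_, key'⟩

/-! ### Odd factors close to 1 -/

theorem fwdDiff_iter_pow_nat_eq_zero_of_lt {j n : ℕ} (h : j < n) (x : ℕ) :
    (fwdDiff 1)^[n] (fun r : ℕ => (r : ℤ) ^ j) x = 0 := by
  have := congrFun (fwdDiff_iter_pow_eq_zero_of_lt (R := ℤ) h) x
  rw [fwdDiff_iter_eq_sum_shift] at this ⊢
  simpa using this

/-- Expand binomially in z: the term of degree r+1 carries 2^(r+1) and a binomial coefficient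
divisible by 2^(s₂(r+1)), which pays for the j-th difference of z^(r+1). -/
theorem diffDvd_four_odd_pow_sub_one {n : ℕ} (hn : 0 < n) :
    DiffDvd 4 2 (2 ^ (n - 1)) ((fun z : ℕ => 2 * (z : ℤ) + 1) ^ 2 ^ n - 1) := by
  obtain ⟨n, rfl⟩ : ∃ k, n = k + 1 := ⟨n - 1, by omega⟩
  rw [Nat.add_sub_cancel]
  have hexp : ((fun z : ℕ => 2 * (z : ℤ) + 1) ^ 2 ^ (n + 1) - 1 : ℕ → ℤ)
      = ∑ r ∈ Finset.range (2 ^ (n + 1)),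
        ((2 : ℤ) ^ (r + 1) * ((2 ^ (n + 1)).choose (r + 1) : ℤ)) •
          fun z : ℕ => (z : ℤ) ^ (r + 1) := by
    ext z
    simp only [Pi.sub_apply, Pi.pow_apply, Pi.one_apply, Finset.sum_apply, Pi.smul_apply,
      smul_eq_mul, add_pow, one_pow, mul_one]
    rw [Finset.sum_range_succ']
    simp only [pow_zero, Nat.choose_zero_right, Nat.cast_one, mul_one, add_sub_cancel_right]
    refine Finset.sum_congr rfl fun r _ => ?_
    rw [mul_pow]; ring
  intro j x hx
  rw [hexp, fwdDiff_iter_finsetSum, Finset.sum_apply]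
  refine Finset.dvd_sum fun r hr => ?_
  rw [Finset.mem_range] at hr
  rw [fwdDiff_iter_const_smul, Pi.smul_apply, smul_eq_mul]
  rcases lt_or_ge (r + 1) j with hlt | hge
  · rw [fwdDiff_iter_pow_nat_eq_zero_of_lt hlt, mul_zero]; exact dvd_zero _
  have h1 : (2 : ℤ) ^ j ∣ 2 ^ s₂ (r + 1) * (fwdDiff 1)^[j] (fun z : ℕ => (z : ℤ) ^ (r + 1)) x := by
    have hz := diffDvd_two_smul_sub_const (x + j + 1) 0
    have := hz.pow_of_two_smul (r + 1) j x (by omega)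
    rw [fwdDiff_iter_const_smul, Pi.smul_apply, smul_eq_mul, one_mul] at this
    simpa [Pi.pow_def] using this
  have h2 : (2 : ℤ) ^ (j + 1) * 2 ^ s₂ (r + 1) ∣
      2 ^ (r + 1) * ((2 ^ (n + 1)).choose (r + 1) : ℤ) := by
    have hb : ∀ t, r + 1 < 2 ^ t → t ≤ n + 1 →
        (2 : ℤ) ^ (n + 1 - t + s₂ (r + 1)) ∣ ((2 ^ (n + 1)).choose (r + 1) : ℤ) := by
      intro t ht htn
      have := two_pow_dvd_choose 1 0 (by omega) ht htn
      rw [one_mul, mul_zero, zero_add] at this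
      exact_mod_cast this
    rcases Nat.lt_or_ge (r + 1) (2 ^ (n + 1)) with h3 | h3
    -- When the degree equals j, one factor 2 is missing; j < 2^n lets the binomial bound be used at
    -- level n, which supplies it.
    · rcases hge.eq_or_lt with h4 | h4
      · have := hb n (by omega) (by omega)
        rw [show n + 1 - n + s₂ (r + 1) = 1 + s₂ (r + 1) by omega] at this
        rw [h4, pow_succ, mul_assoc, ← pow_succ']
        refine mul_dvd_mul_left _ ((pow_dvd_pow 2 (by omega)).trans this)
      · have := hb (n + 1) h3 le_rfl
        rw [Nat.sub_self, zero_add] at this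
        exact mul_dvd_mul (pow_dvd_pow 2 (by omega)) this
    · have h5 : r + 1 = 2 ^ (n + 1) := by omega
      have h6 : s₂ (r + 1) = 1 := by
        rw [h5]; simpa [s₂] using s₂_two_pow_add (k := n + 1) (a := 0) (by positivity)
      rw [h6, ← pow_add]
      refine Dvd.dvd.mul_right (pow_dvd_pow 2 ?_) _
      have : 2 ^ (n + 1) = 2 * 2 ^ n := by ring
      omega
  obtain ⟨k, hk⟩ := h2
  rw [hk]
  have : (2 : ℤ) ^ (j + 1) * 2 ^ s₂ (r + 1) * k *
      (fwdDiff 1)^[j] (fun z : ℕ => (z : ℤ) ^ (r + 1)) x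
      = k * (2 ^ (j + 1) * (2 ^ s₂ (r + 1) * (fwdDiff 1)^[j] (fun z : ℕ => (z : ℤ) ^ (r + 1)) x)) := by
    ring
  rw [this]
  refine Dvd.dvd.mul_left ?_ _
  refine (dvd_of_eq ?_).trans (mul_dvd_mul_left _ h1)
  rw [show (4 : ℤ) = 2 * 2 by norm_num, mul_pow]; ring

theorem diffDvd_four_mul_add_one_sq_sub_one (d : ℕ) :
    DiffDvd 4 2 d ((fun z : ℕ => 4 * (z : ℤ) + 1) ^ 2 - 1) := by
  rcases d with _ | _ | d
  · intro j x hx; omega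
  · refine DiffDvd.of_diff (fun x _ => ⟨8 * x ^ 2 + 4 * x, ?_⟩) fun j x hx => by omega
    simp; ring
  refine DiffDvd.of_diff (fun x _ => ⟨8 * x ^ 2 + 4 * x, ?_⟩)
    (DiffDvd.of_diff (fun x _ => ⟨4 * x + 3, ?_⟩) ?_)
  · simp; ring
  · simp [fwdDiff]; ring
  · have : Δ_[1] (Δ_[1] ((fun z : ℕ => 4 * (z : ℤ) + 1) ^ 2 - 1)) = fun _ => 32 := by
      ext x; simp [fwdDiff]; ring
    rw [this]
    exact DiffDvd.const (by norm_num)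

/-! ### Functions supported on 2 modulo 4 -/

/-- Spread a function on `ℕ` out over the residue class of `2` modulo `4`, by zero elsewhere. -/
def spread (f : ℕ → ℤ) (y : ℕ) : ℤ := if y % 4 = 2 then f (y / 4) else 0

/-- Shifting by 4 on the spread function is shifting by 1 on f, so (1+Δ)^4 - 1 acts as Δ inside
`spread`. -/
theorem fwdDiff_iter_spread (f : ℕ → ℤ) (a x : ℕ) :
    (fwdDiff 1)^[a + 4] (spread f) x
      = (fwdDiff 1)^[a] (spread (Δ_[1] f)) x - 4 * (fwdDiff 1)^[a + 3] (spread f) x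
        - 6 * (fwdDiff 1)^[a + 2] (spread f) x - 4 * (fwdDiff 1)^[a + 1] (spread f) x := by
  have : spread (Δ_[1] f) = (fwdDiff 1)^[4] (spread f) + (4 : ℤ) • (fwdDiff 1)^[3] (spread f)
      + (6 : ℤ) • (fwdDiff 1)^[2] (spread f) + (4 : ℤ) • (fwdDiff 1)^[1] (spread f) := by
    ext y
    have h1 : spread (Δ_[1] f) y = spread f (y + 4) - spread f y := by
      simp only [spread, fwdDiff, Nat.add_mod_right, Nat.add_div_right y (show 0 < 4 by norm_num)]
      split_ifs <;> simp
    rw [h1]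
    simp [fwdDiff, add_assoc]
    ring
  rw [this]
  simp only [fwdDiff_iter_add, fwdDiff_iter_const_smul, Pi.add_apply, Pi.smul_apply, smul_eq_mul,
    ← Function.iterate_add_apply]
  ring

/-- In the recursion a drop of 4 in the order is paid by the factor 4 of Δf, and the coefficients 4,
6, 4 pay for the other terms. -/
theorem DiffDvd.two_pow_dvd_fwdDiff_iter_spread {c : ℤ} {d : ℕ} {f : ℕ → ℤ}
    (hf : DiffDvd 4 c d f) (a x : ℕ) (hx : x + a < 4 * d) :
    c * 2 ^ (a / 2 - 1) ∣ (fwdDiff 1)^[a] (spread f) x := by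
  induction a using Nat.strong_induction_on generalizing c d f with
  | _ a ih =>
    rcases Nat.lt_or_ge a 4 with ha | ha
    · have h0 : ∀ y < 4 * d, c ∣ spread f y := by
        intro y hy
        unfold spread
        split_ifs
        · exact hf.apply_dvd (by omega)
        · exact dvd_zero _
      have := DiffDvd.of_forall_dvd h0 a x hx
      rw [show a / 2 - 1 = 0 by omega]
      simpa using this
    obtain ⟨b, rfl⟩ : ∃ b, a = b + 4 := ⟨a - 4, by omega⟩
    obtain ⟨d, rfl⟩ : ∃ e, d = e + 1 := ⟨d - 1, by omega⟩
    rw [fwdDiff_iter_spread]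
    have hpow : ∀ {i k : ℕ}, i ≤ k → c * (2 : ℤ) ^ i ∣ c * 2 ^ k := fun h =>
      mul_dvd_mul_left _ (pow_dvd_pow 2 h)
    refine dvd_sub (dvd_sub (dvd_sub ?_ ?_) ?_) ?_
    · refine Dvd.dvd.trans ?_ (ih b (by omega) hf.diff (by omega))
      rw [show c * 4 * (2 : ℤ) ^ (b / 2 - 1) = c * 2 ^ (b / 2 - 1 + 2) by ring]
      exact hpow (by omega)
    · refine Dvd.dvd.trans ?_ (mul_dvd_mul_left 4 (ih (b + 3) (by omega) hf (by omega)))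
      rw [show 4 * (c * (2 : ℤ) ^ ((b + 3) / 2 - 1)) = c * 2 ^ ((b + 3) / 2 - 1 + 2) by ring]
      exact hpow (by omega)
    · refine Dvd.dvd.trans ?_ (mul_dvd_mul_left 6 (ih (b + 2) (by omega) hf (by omega)))
      rw [show 6 * (c * (2 : ℤ) ^ ((b + 2) / 2 - 1)) = c * 2 ^ ((b + 2) / 2 - 1 + 1) * 3 by ring]
      exact (hpow (by omega)).mul_right _
    · refine Dvd.dvd.trans ?_ (mul_dvd_mul_left 4 (ih (b + 1) (by omega) hf (by omega)))
      rw [show 4 * (c * (2 : ℤ) ^ ((b + 1) / 2 - 1)) = c * 2 ^ ((b + 1) / 2 - 1 + 2) by ring]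
      exact hpow (by omega)

/-- The general bound is sharp at odd orders: Δ1 = 0, and among the remaining terms only the one
with coefficient 6 has minimal valuation. -/
theorem fwdDiff_iter_spread_one_odd (k : ℕ) :
    ∃ u : ℤ, (fwdDiff 1)^[2 * k + 3] (spread 1) 0 = 2 ^ k * (2 * u + 1) := by
  induction k with
  | zero => exact ⟨-2, by simp [fwdDiff, spread]⟩
  | succ k ih =>
    obtain ⟨u, hu⟩ := ih
    have hdvd (a : ℕ) : (2 : ℤ) ^ (a / 2 - 1) ∣ (fwdDiff 1)^[a] (spread 1) 0 := by
      have : DiffDvd 4 1 (a + 1) 1 := DiffDvd.const (k := 1) (one_dvd _)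
      simpa using this.two_pow_dvd_fwdDiff_iter_spread a 0 (by omega)
    have hzero : spread (Δ_[1] 1) = 0 := by ext y; simp [spread, fwdDiff]
    have hrec := fwdDiff_iter_spread 1 (2 * k + 1) 0
    rw [hzero, Function.iterate_fixed (x := (0 : ℕ → ℤ)) (by ext; simp [fwdDiff])] at hrec
    obtain ⟨v, hv⟩ := hdvd (2 * k + 4)
    obtain ⟨w, hw⟩ := hdvd (2 * k + 2)
    rw [show (2 * k + 4) / 2 - 1 = k + 1 by omega] at hv
    rw [show (2 * k + 2) / 2 - 1 = k by omega] at hw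
    refine ⟨-2 * v - 3 * u - 2 - w, ?_⟩
    rw [show 2 * (k + 1) + 3 = 2 * k + 1 + 4 by ring, hrec,
      show 2 * k + 1 + 3 = 2 * k + 4 by ring, show 2 * k + 1 + 2 = 2 * k + 3 by ring,
      show 2 * k + 1 + 1 = 2 * k + 2 by ring, hu, hv, hw]
    simp
    ring

/-! ### The Stirling functional -/

/-- The linear functional on `ℤ[X]` sending `X ^ N` to `S(N, a)`, i.e. the coefficient of the
`a`-th falling factorial. -/
noncomputable def stirlingLin (a : ℕ) : ℤ[X] →ₗ[ℤ] ℤ :=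
  Polynomial.lsum fun i => (Nat.stirlingSecond i a : ℤ) • LinearMap.id

theorem stirlingLin_monomial (a N : ℕ) (z : ℤ) :
    stirlingLin a (monomial N z) = Nat.stirlingSecond N a * z := by
  simp [stirlingLin, Polynomial.lsum_apply]

theorem stirlingLin_X_pow (a N : ℕ) : stirlingLin a (X ^ N) = Nat.stirlingSecond N a := by
  rw [← monomial_one_right_eq_X_pow, stirlingLin_monomial, mul_one]

theorem stirlingLin_eq_zero_of_natDegree_lt {a : ℕ} {p : ℤ[X]} (h : p.natDegree < a) :
    stirlingLin a p = 0 := by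
  rw [stirlingLin, Polynomial.lsum_apply, Polynomial.sum_def]
  refine Finset.sum_eq_zero fun i hi => ?_
  rw [Nat.stirlingSecond_eq_zero_of_lt ((le_natDegree_of_mem_supp i hi).trans_lt h)]
  simp

theorem dvd_stirlingLin {M : ℤ} {p : ℤ[X]} (a : ℕ) (h : C M ∣ p) : M ∣ stirlingLin a p := by
  obtain ⟨q, rfl⟩ := h
  rw [← smul_eq_C_mul, map_smul, smul_eq_mul]
  exact Dvd.intro _ rfl

theorem fwdDiff_iter_id_mul (g : ℕ → ℤ) (k x : ℕ) :
    (fwdDiff 1)^[k + 1] (fun y : ℕ => (y : ℤ) * g y) x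
      = x * (fwdDiff 1)^[k + 1] g x + (k + 1) * (fwdDiff 1)^[k] g (x + 1) := by
  induction k generalizing x with
  | zero => simp [fwdDiff]; ring
  | succ k ih =>
    have hs (f : ℕ → ℤ) (j y : ℕ) : (fwdDiff 1)^[j] f (y + 1)
        = (fwdDiff 1)^[j + 1] f y + (fwdDiff 1)^[j] f y := by
      rw [Function.iterate_succ_apply', fwdDiff]; ring
    rw [Function.iterate_succ_apply', fwdDiff, ih, ih, hs g k (x + 1), hs g (k + 1) x]
    push_cast
    ring

theorem factorial_mul_stirlingSecond (N a : ℕ) :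
    (a ! : ℤ) * Nat.stirlingSecond N a = (fwdDiff 1)^[a] (fun y : ℕ => (y : ℤ) ^ N) 0 := by
  induction N generalizing a with
  | zero =>
    cases a with
    | zero => simp
    | succ a => rw [fwdDiff_iter_pow_nat_eq_zero_of_lt (by omega)]; simp
  | succ N ih =>
    cases a with
    | zero => simp
    | succ a =>
      have h1 := fwdDiff_iter_id_mul (fun y : ℕ => (y : ℤ) ^ N) a 0
      simp only [pow_succ', Nat.stirlingSecond_succ_succ]
      rw [h1]
      have h2 : (fwdDiff 1)^[a] (fun y : ℕ => (y : ℤ) ^ N) (0 + 1)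
          = (fwdDiff 1)^[a + 1] (fun y : ℕ => (y : ℤ) ^ N) 0
            + (fwdDiff 1)^[a] (fun y : ℕ => (y : ℤ) ^ N) 0 := by
        rw [Function.iterate_succ_apply', fwdDiff]; ring
      rw [h2, ← ih, ← ih, Nat.factorial_succ]
      push_cast
      ring

theorem factorial_mul_stirlingLin (a : ℕ) (p : ℤ[X]) :
    (a ! : ℤ) * stirlingLin a p = (fwdDiff 1)^[a] (fun y : ℕ => p.eval (y : ℤ)) 0 := by
  induction p using Polynomial.induction_on' with
  | add p q hp hq =>
    rw [map_add, mul_add, hp, hq, ← Pi.add_apply, ← fwdDiff_iter_add]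
    simp only [eval_add]; rfl
  | monomial N z =>
    have : (fun y : ℕ => (monomial N z).eval (y : ℤ)) = z • fun y : ℕ => (y : ℤ) ^ N := by
      ext y; simp
    rw [stirlingLin_monomial, this, fwdDiff_iter_const_smul, Pi.smul_apply,
      ← factorial_mul_stirlingSecond, smul_eq_mul]
    ring

theorem stirlingLin_X_mul (a : ℕ) (p : ℤ[X]) :
    stirlingLin (a + 1) (X * p) = stirlingLin a (p.comp (X + 1)) := by
  refine mul_left_cancel₀ (Nat.cast_ne_zero.2 (a + 1).factorial_ne_zero : ((a + 1)! : ℤ) ≠ 0) ?_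
  rw [factorial_mul_stirlingLin, Nat.factorial_succ, Nat.cast_mul, mul_assoc,
    factorial_mul_stirlingLin]
  simp only [eval_mul, eval_X, eval_comp, eval_add, eval_one]
  rw [fwdDiff_iter_id_mul fun y : ℕ => p.eval (y : ℤ)]
  have := fwdDiff_iter_comp_add 1 (fun y : ℕ => p.eval (y : ℤ)) 1 a 0
  push_cast at this ⊢
  rw [this]; simp

/-- Iterates `stirlingLin_X_mul`, peeling off one linear factor and shifting the variable by 1 each
time. -/
theorem stirlingLin_descPochhammer_mul (A a : ℕ) (p : ℤ[X]) :
    stirlingLin (A + a) (descPochhammer ℤ A * p) = stirlingLin a (p.comp (X + (A : ℤ[X]))) := by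
  induction A generalizing p with
  | zero => simp
  | succ A ih =>
    rw [show A + 1 + a = A + a + 1 by ring, descPochhammer_succ_left, mul_assoc,
      stirlingLin_X_mul, mul_comp, comp_assoc]
    simp only [sub_comp, X_comp, one_comp, add_sub_cancel_right, comp_X]
    rw [ih, comp_assoc]
    congr 2
    simp; ring

/-! ### Falling factorials modulo powers of 2 -/

theorem C_dvd_comp_add_sub (M k : ℤ) (h : M ∣ k) (p : ℤ[X]) : C M ∣ p.comp (X + C k) - p := by
  have h1 := Polynomial.sub_dvd_eval_sub (X + C k) X (p.map C)
  rw [eval_map, eval_map, ← Polynomial.comp, ← Polynomial.comp, comp_X, add_sub_cancel_left] at h1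
  exact (map_dvd C h).trans h1

/-- Doubling the length multiplies D by a translate that is congruent to D; then D² - Q² =
(D-Q)(D-Q+2Q) gains a factor 2, as D ≡ Q mod 2. -/
theorem two_pow_dvd_descPochhammer_two_pow_sub (j : ℕ) :
    C ((2 : ℤ) ^ j) ∣ descPochhammer ℤ (2 ^ (j + 1)) - (X ^ 2 - X) ^ 2 ^ j := by
  induction j with
  | zero => simp
  | succ j ih =>
    have h2 : C (2 : ℤ) ∣ descPochhammer ℤ (2 ^ (j + 1)) - (X ^ 2 - X) ^ 2 ^ j := by
      cases j with
      | zero =>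
        rw [show 2 ^ (0 + 1) = 1 + 1 by norm_num, descPochhammer_succ_left, descPochhammer_one]
        simp [sq, mul_sub]
      | succ j => exact (map_dvd C (Dvd.intro_left _ (pow_succ (2 : ℤ) j).symm)).trans ih
    set D := descPochhammer ℤ (2 ^ (j + 1)) with hD
    set Q : ℤ[X] := (X ^ 2 - X) ^ 2 ^ j with hQ
    have hmul : descPochhammer ℤ (2 ^ (j + 1 + 1)) = D * D.comp (X + C (-2 ^ (j + 1) : ℤ)) := by
      rw [pow_succ 2 (j + 1), mul_two, ← descPochhammer_mul, ← hD]
      congr 2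
      simp [sub_eq_add_neg]
    have hsq : (X ^ 2 - X : ℤ[X]) ^ 2 ^ (j + 1) = Q ^ 2 := by rw [hQ, ← pow_mul, pow_succ 2 j]
    rw [hmul, hsq, show D * D.comp (X + C (-2 ^ (j + 1) : ℤ)) - Q ^ 2
      = D * (D.comp (X + C (-2 ^ (j + 1) : ℤ)) - D) + (D - Q) * (D - Q + C 2 * Q) by
        rw [show (C 2 : ℤ[X]) = 2 from rfl]; ring]
    refine dvd_add (Dvd.dvd.mul_left (C_dvd_comp_add_sub _ _ ((dvd_neg).2 dvd_rfl) _) _) ?_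
    rw [pow_succ, C_mul]
    exact mul_dvd_mul ih (dvd_add h2 (Dvd.intro _ rfl))

theorem two_pow_dvd_descPochhammer_sub (j r : ℕ) :
    C ((2 : ℤ) ^ j) ∣ descPochhammer ℤ (r * 2 ^ (j + 1)) - (X ^ 2 - X) ^ (r * 2 ^ j) := by
  induction r with
  | zero => simp
  | succ r ih =>
    set D := descPochhammer ℤ (2 ^ (j + 1)) with hD
    have hmul : descPochhammer ℤ ((r + 1) * 2 ^ (j + 1))
        = descPochhammer ℤ (r * 2 ^ (j + 1)) * D.comp (X + C (-(r * 2 ^ (j + 1)) : ℤ)) := by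
      rw [add_mul, one_mul, ← descPochhammer_mul, ← hD]
      congr 2
      simp [sub_eq_add_neg]
    rw [hmul, add_mul, one_mul, pow_add (X ^ 2 - X : ℤ[X]),
      show ∀ E D' D Q R : ℤ[X], E * D' - Q * R = E * (D' - D) + E * (D - R) + (E - Q) * R by
        intros; ring]
    refine dvd_add (dvd_add ((C_dvd_comp_add_sub _ _ ?_ D).mul_left _)
      ((two_pow_dvd_descPochhammer_two_pow_sub j).mul_left _)) (ih.mul_right _)
    exact (dvd_neg).2 ⟨r * 2, by ring⟩

theorem two_pow_dvd_stirlingLin_sub (j r a : ℕ) (p : ℤ[X]) :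
    (2 : ℤ) ^ j ∣ stirlingLin (r * 2 ^ (j + 1) + a) ((X ^ 2 - X) ^ (r * 2 ^ j) * p)
      - stirlingLin a p := by
  have h1 := dvd_stirlingLin (r * 2 ^ (j + 1) + a)
    ((two_pow_dvd_descPochhammer_sub j r).mul_right p)
  have h2 := dvd_stirlingLin a (C_dvd_comp_add_sub (2 ^ j) (r * 2 ^ (j + 1)) ⟨r * 2, by ring⟩ p)
  rw [sub_mul, map_sub, stirlingLin_descPochhammer_mul] at h1
  rw [map_sub] at h2
  have h3 : (X + C (r * 2 ^ (j + 1) : ℤ) : ℤ[X]) = X + ((r * 2 ^ (j + 1) : ℕ) : ℤ[X]) := by simp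
  rw [h3] at h2
  have := dvd_sub h2 h1
  rwa [sub_sub_sub_cancel_left] at this

/-! ### The limiting value t -/

theorem two_pow_dvd_mul_stirlingLin_iff (a : ℕ) (e : ℤ) (p : ℤ[X]) :
    (2 : ℤ) ^ s₂ a ∣ e * stirlingLin a p ↔
      (2 : ℤ) ^ a ∣ e * (fwdDiff 1)^[a] (fun y : ℕ => p.eval (y : ℤ)) 0 := by
  rw [← factorial_mul_stirlingLin, ← two_pow_dvd_factorial_mul_iff, mul_left_comm]

/-- For odd y the power of y-1 vanishes modulo 2^(2^(n+1)), for 4 ∣ y the power of y does; for y =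
4z+2 there is equality. -/
theorem two_pow_dvd_sub_spread_odd_part {n i : ℕ} (hi : 0 < i) (y : ℕ) :
    (2 : ℤ) ^ 2 ^ (n + 1) ∣ (y : ℤ) ^ 2 ^ n * ((y : ℤ) - 1) ^ (2 ^ (n + 1) * i)
      - 2 ^ 2 ^ n * spread ((fun z : ℕ => 2 * (z : ℤ) + 1) ^ 2 ^ n *
        ((fun z : ℕ => 4 * (z : ℤ) + 1) ^ 2) ^ (2 ^ n * i)) y := by
  unfold spread
  split_ifs with h
  · obtain ⟨z, rfl⟩ : ∃ z, y = 4 * z + 2 := ⟨y / 4, by omega⟩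
    rw [show (4 * z + 2) / 4 = z by omega]
    simp only [Pi.mul_apply, Pi.pow_apply]
    have h1 : ((4 * z + 2 : ℕ) : ℤ) - 1 = 4 * z + 1 := by push_cast; ring
    have h2 : ((4 * z + 2 : ℕ) : ℤ) = 2 * (2 * z + 1) := by push_cast; ring
    have h3 : 2 ^ (n + 1) * i = 2 * (2 ^ n * i) := by ring
    rw [h1, h2, h3, pow_mul _ 2, mul_pow, mul_assoc, sub_self]
    exact dvd_zero _
  · rw [mul_zero, sub_zero]
    rcases Nat.even_or_odd y with hy | hy
    · have : (4 : ℤ) ∣ y := by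
        obtain ⟨k, rfl⟩ := hy
        omega
      refine Dvd.dvd.mul_right ?_ _
      rw [pow_succ', pow_mul]
      exact pow_dvd_pow_of_dvd (by norm_num; exact this) _
    · refine Dvd.dvd.mul_left ?_ _
      have : (2 : ℤ) ∣ (y : ℤ) - 1 := by
        obtain ⟨k, rfl⟩ := hy
        omega
      exact (pow_dvd_pow_of_dvd this _).trans (pow_dvd_pow _ (Nat.le_mul_of_pos_right _ hi))

/-- Replacing the odd part f by 1 is harmless: f - 1 brings one extra factor 2, and 2^n + a/2 ≥ a in
this range. -/
theorem two_pow_dvd_fwdDiff_iter_sub_spread {n i a x : ℕ} (hn : 0 < n) (hi : 0 < i)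
    (hx : x + a < 2 ^ (n + 1)) :
    (2 : ℤ) ^ a ∣ (fwdDiff 1)^[a]
        (fun y : ℕ => (y : ℤ) ^ 2 ^ n * ((y : ℤ) - 1) ^ (2 ^ (n + 1) * i)) x
      - 2 ^ 2 ^ n * (fwdDiff 1)^[a] (spread 1) x := by
  set G : ℕ → ℤ := fun y : ℕ => (y : ℤ) ^ 2 ^ n * ((y : ℤ) - 1) ^ (2 ^ (n + 1) * i) with hG
  set f : ℕ → ℤ := (fun z : ℕ => 2 * (z : ℤ) + 1) ^ 2 ^ n *
        ((fun z : ℕ => 4 * (z : ℤ) + 1) ^ 2) ^ (2 ^ n * i) with hf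
  set E : ℕ → ℤ := fun y => G y - 2 ^ 2 ^ n * spread f y with hE
  have hdec : G = E + ((2 : ℤ) ^ 2 ^ n • spread (f - 1) + (2 : ℤ) ^ 2 ^ n • spread 1) := by
    ext y
    simp only [hE, Pi.add_apply, Pi.smul_apply, smul_eq_mul, spread]
    split_ifs
    · simp; ring
    · simp
  have hEd : DiffDvd 1 (2 ^ 2 ^ (n + 1)) (2 ^ (n + 1)) E :=
    DiffDvd.of_forall_dvd fun y _ => two_pow_dvd_sub_spread_odd_part hi y
  have hfd : DiffDvd 4 2 (2 ^ (n - 1)) (f - 1) :=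
    (diffDvd_four_odd_pow_sub_one hn).mul_sub_one
      ((diffDvd_four_mul_add_one_sq_sub_one _).pow_sub_one _)
  have h4 : 2 ^ (n + 1) = 4 * 2 ^ (n - 1) := by
    obtain ⟨n, rfl⟩ : ∃ k, n = k + 1 := ⟨n - 1, by omega⟩
    rw [Nat.add_sub_cancel]; ring
  have h5 : 2 ^ (n + 1) = 2 * 2 ^ n := pow_succ' _ _
  have h6 : a < 2 ^ (n + 1) := by omega
  have h7 : 0 < 2 ^ n := by positivity
  rw [hdec, fwdDiff_iter_add, fwdDiff_iter_add, fwdDiff_iter_const_smul, fwdDiff_iter_const_smul]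
  simp only [Pi.add_apply, Pi.smul_apply, smul_eq_mul]
  rw [← add_assoc, add_sub_cancel_right]
  refine dvd_add ?_ ?_
  · have := hEd a x hx
    rw [one_pow, mul_one] at this
    exact (pow_dvd_pow 2 h6.le).trans this
  · refine Dvd.dvd.trans ?_ (mul_dvd_mul_left _
      (hfd.two_pow_dvd_fwdDiff_iter_spread a x (by omega)))
    rw [← pow_succ', ← pow_add]
    exact pow_dvd_pow 2 (by omega)

theorem diffDvd_two_smul_pow_mul_pow {n i : ℕ} (hn : 0 < n) (hi : 0 < i) :
    DiffDvd 2 1 (2 ^ (n + 1))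
      ((2 : ℤ) • fun y : ℕ => (y : ℤ) ^ 2 ^ n * ((y : ℤ) - 1) ^ (2 ^ (n + 1) * i)) := by
  intro a x hx
  have h5 : 2 ^ (n + 1) = 2 * 2 ^ n := pow_succ' _ _
  have h1 : (2 : ℤ) ^ (a / 2 - 1) ∣ (fwdDiff 1)^[a] (spread 1) x := by
    have : DiffDvd 4 1 (2 ^ (n + 1)) 1 := DiffDvd.const (k := 1) (one_dvd _)
    simpa using this.two_pow_dvd_fwdDiff_iter_spread a x (by omega)
  have h2 : (2 : ℤ) ^ a ∣ 2 * (2 ^ 2 ^ n * (fwdDiff 1)^[a] (spread 1) x) := by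
    refine Dvd.dvd.trans ?_ (mul_dvd_mul_left _ (mul_dvd_mul_left _ h1))
    rw [← pow_add, ← pow_succ']
    exact pow_dvd_pow 2 (by omega)
  rw [fwdDiff_iter_const_smul, Pi.smul_apply, smul_eq_mul, one_mul]
  have := dvd_add ((two_pow_dvd_fwdDiff_iter_sub_spread hn hi hx).mul_left 2) h2
  rwa [← mul_add, sub_add_cancel] at this

/-- The functional that governs the final answer: its value modulo `2 ^ s₂ a`. -/
theorem two_pow_dvd_stirlingLin_pow_mul_pow_sub {n i i' a : ℕ} (hn : 0 < n) (hi : 0 < i)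
    (hi' : 0 < i') (ha : a < 2 ^ (n + 1)) :
    (2 : ℤ) ^ s₂ a ∣ stirlingLin a (X ^ 2 ^ n * (X - 1) ^ (2 ^ (n + 1) * i))
      - stirlingLin a (X ^ 2 ^ n * (X - 1) ^ (2 ^ (n + 1) * i')) := by
  rw [← two_pow_dvd_factorial_mul_iff, mul_sub, factorial_mul_stirlingLin,
    factorial_mul_stirlingLin]
  simp only [eval_mul, eval_pow, eval_X, eval_sub, eval_one]
  have := dvd_sub (two_pow_dvd_fwdDiff_iter_sub_spread (a := a) (x := 0) hn hi (by omega))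
    (two_pow_dvd_fwdDiff_iter_sub_spread (x := 0) hn hi' (by omega))
  rwa [sub_sub_sub_cancel_right] at this

theorem two_pow_dvd_two_mul_stirlingLin {n i a : ℕ} (hn : 0 < n) (hi : 0 < i)
    (ha : a < 2 ^ (n + 1)) :
    (2 : ℤ) ^ s₂ a ∣ 2 * stirlingLin a (X ^ 2 ^ n * (X - 1) ^ (2 ^ (n + 1) * i)) := by
  rw [two_pow_dvd_mul_stirlingLin_iff]
  simp only [eval_mul, eval_pow, eval_X, eval_sub, eval_one]
  have := diffDvd_two_smul_pow_mul_pow hn hi a 0 (by omega)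
  rwa [fwdDiff_iter_const_smul, Pi.smul_apply, smul_eq_mul, one_mul] at this

theorem two_pow_dvd_stirlingLin_iff_ne {n i a : ℕ} (hn : 0 < n) (hi : 0 < i)
    (ha : a < 2 ^ (n + 1)) :
    (2 : ℤ) ^ s₂ a ∣ stirlingLin a (X ^ 2 ^ n * (X - 1) ^ (2 ^ (n + 1) * i)) ↔
      a ≠ 2 ^ (n + 1) - 1 := by
  have h5 : 2 ^ (n + 1) = 2 * 2 ^ n := pow_succ' _ _
  have key := two_pow_dvd_mul_stirlingLin_iff a 1 (X ^ 2 ^ n * (X - 1) ^ (2 ^ (n + 1) * i))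
  simp only [one_mul, eval_mul, eval_pow, eval_X, eval_sub, eval_one] at key
  rw [key, dvd_iff_dvd_of_dvd_sub (two_pow_dvd_fwdDiff_iter_sub_spread hn hi (by omega))]
  constructor
  · rintro h rfl
    have hpos : 2 ≤ 2 ^ n := Nat.le_self_pow hn.ne' 2
    obtain ⟨u, hu⟩ := fwdDiff_iter_spread_one_odd (2 ^ n - 2)
    -- At this a the exact valuation is 2^n + (2^n - 2) = a - 1, one short of a.
    rw [show 2 * (2 ^ n - 2) + 3 = 2 ^ (n + 1) - 1 by omega] at hu
    rw [hu, ← mul_assoc, ← pow_add, show 2 ^ (n + 1) - 1 = 2 ^ n + (2 ^ n - 2) + 1 by omega,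
      pow_succ, mul_dvd_mul_iff_left (by positivity)] at h
    omega
  · intro hne
    have h1 : (2 : ℤ) ^ (a / 2 - 1) ∣ (fwdDiff 1)^[a] (spread 1) 0 := by
      have : DiffDvd 4 1 (a + 1) 1 := DiffDvd.const (k := 1) (one_dvd _)
      simpa using this.two_pow_dvd_fwdDiff_iter_spread a 0 (by omega)
    refine Dvd.dvd.trans ?_ (mul_dvd_mul_left _ h1)
    rw [← pow_add]
    exact pow_dvd_pow 2 (by omega)

/-! ### Binomial expansion and conclusion -/

theorem stirlingSecond_pos {N K : ℕ} (hK : 0 < K) (h : K ≤ N) : 0 < Nat.stirlingSecond N K := by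
  induction N with
  | zero => omega
  | succ N ih =>
    obtain ⟨k, rfl⟩ : ∃ k, K = k + 1 := ⟨K - 1, by omega⟩
    rcases h.eq_or_lt with h | h
    · rw [h, Nat.stirlingSecond_self]; exact one_pos
    · rw [Nat.stirlingSecond_succ_succ]
      have := ih (by omega)
      positivity

theorem two_pow_dvd_mul_stirlingLin_mul_X_sub_one_pow {a d : ℕ} (ha : a < d) {p : ℤ[X]}
    (hp : DiffDvd 2 1 d ((2 : ℤ) • fun y : ℕ => p.eval (y : ℤ))) (r : ℕ) :
    (2 : ℤ) ^ s₂ a ∣ 2 ^ (1 + s₂ r) * stirlingLin a (p * (X - 1) ^ r) := by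
  rw [two_pow_dvd_mul_stirlingLin_iff]
  have := hp.mul ((diffDvd_two_smul_sub_const d 1).pow_of_two_smul r) a 0 (by omega)
  rw [smul_mul_smul_comm, fwdDiff_iter_const_smul, Pi.smul_apply, smul_eq_mul, ← pow_succ',
    one_mul, one_mul] at this
  simpa [add_comm, Pi.mul_def, Pi.pow_def] using this

theorem diffDvd_two_smul_eval_X_pow (d k : ℕ) :
    DiffDvd 2 1 d ((2 : ℤ) • fun y : ℕ => (X ^ 2 ^ k : ℤ[X]).eval (y : ℤ)) := by
  have := (diffDvd_two_smul_sub_const d 0).two_smul_pow_two_pow k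
  simpa [Pi.pow_def] using this

theorem two_pow_dvd_mul_stirlingLin_X_pow_mul {n a r : ℕ} (hn : 0 < n) (ha : a < 2 ^ (n + 1))
    (i : ℕ) :
    (2 : ℤ) ^ s₂ a ∣
      2 ^ (1 + s₂ r) * stirlingLin a (X ^ 2 ^ n * (X - 1) ^ (2 ^ (n + 1) * i + r)) := by
  rw [pow_add (X - 1 : ℤ[X]), ← mul_assoc (X ^ 2 ^ n)]
  refine two_pow_dvd_mul_stirlingLin_mul_X_sub_one_pow ha ?_ r
  rcases Nat.eq_zero_or_pos i with rfl | hi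
  · simpa using diffDvd_two_smul_eval_X_pow (2 ^ (n + 1)) n
  · simpa using diffDvd_two_smul_pow_mul_pow hn hi

theorem two_pow_dvd_stirlingLin_high (b n a i : ℕ) :
    (2 : ℤ) ^ (n + 1) ∣ stirlingLin (b * 2 ^ (n + 2) + a)
        (X ^ (b * 2 ^ (n + 1) + 2 ^ n) * (X - 1) ^ (b * 2 ^ (n + 1) + i))
      - stirlingLin a (X ^ 2 ^ n * (X - 1) ^ i) := by
  have := two_pow_dvd_stirlingLin_sub (n + 1) b a (X ^ 2 ^ n * (X - 1) ^ i)
  rwa [show (X ^ 2 - X : ℤ[X]) = X * (X - 1) by ring, mul_pow, mul_mul_mul_comm, ← pow_add,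
    ← pow_add] at this

theorem two_pow_dvd_stirlingLin_mid (b n a r : ℕ) :
    (2 : ℤ) ^ n ∣ stirlingLin ((b + 1) * 2 ^ (n + 2) + a)
        (X ^ ((b + 1) * 2 ^ (n + 1) + 2 ^ n) * (X - 1) ^ ((2 * b + 1) * 2 ^ n + r))
      - stirlingLin (2 ^ (n + 1) + a) (X ^ 2 ^ (n + 1) * (X - 1) ^ r) := by
  have := two_pow_dvd_stirlingLin_sub n (2 * b + 1) (2 ^ (n + 1) + a)
    (X ^ 2 ^ (n + 1) * (X - 1) ^ r)
  rw [show (X ^ 2 - X : ℤ[X]) = X * (X - 1) by ring, mul_pow, mul_mul_mul_comm, ← pow_add,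
    ← pow_add, ← add_assoc] at this
  rwa [show (2 * b + 1) * 2 ^ (n + 1) + 2 ^ (n + 1) = (b + 1) * 2 ^ (n + 2) by ring,
    show (2 * b + 1) * 2 ^ n + 2 ^ (n + 1) = (b + 1) * 2 ^ (n + 1) + 2 ^ n by ring] at this

theorem two_dvd_choose {c m k : ℕ} (hk : ¬ 2 ^ m ∣ k) : 2 ∣ (c * 2 ^ m).choose k := by
  have hr : 0 < k % 2 ^ m := Nat.pos_of_ne_zero fun h => hk (Nat.dvd_of_mod_eq_zero h)
  have := two_pow_dvd_choose c (k / 2 ^ m) hr (Nat.mod_lt k (by positivity)) le_rfl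
  rw [Nat.div_add_mod, Nat.sub_self, zero_add] at this
  exact (dvd_pow_self 2 (s₂_pos hr).ne').trans this

/-- Since 2t ≡ 0, an even binomial coefficient kills t, and it remains to kill l. Small k vanish by
degree, and for the others the digit sum of the remainder of k is paid by the binomial coefficient.
Only for k = b2^(n+1) + 2^(n+1)·i₁ with i₁ > 0 may the coefficient be odd, and there l ≡ t itself.
-/
theorem two_pow_dvd_choose_mul_stirlingLin_sub {a b c m n k : ℕ} (hn : 0 < n) (ha1 : 1 ≤ a)
    (ha : a < 2 ^ (n + 1)) (hm : n + 2 ≤ m) (hb : 0 < b) (hbm : b * 2 ^ (n + 1) < 2 ^ m)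
    (hk : 0 < k) :
    (2 : ℤ) ^ s₂ a ∣ ((c * 2 ^ m).choose k : ℤ) *
      (stirlingLin (b * 2 ^ (n + 2) + a) (X ^ (b * 2 ^ (n + 1) + 2 ^ n) * (X - 1) ^ k)
        - stirlingLin a (X ^ 2 ^ n * (X - 1) ^ (2 ^ (n + 1) * 1))) := by
  set t := stirlingLin a (X ^ 2 ^ n * (X - 1) ^ (2 ^ (n + 1) * 1)) with ht
  set l := stirlingLin (b * 2 ^ (n + 2) + a) (X ^ (b * 2 ^ (n + 1) + 2 ^ n) * (X - 1) ^ k) with hl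
  have hs : s₂ a ≤ n + 1 := s₂_le_of_lt ha
  have h2n : 2 ^ (n + 1) = 2 * 2 ^ n := pow_succ' _ _
  have h2n' : 2 ^ (n + 2) = 4 * 2 ^ n := by ring
  have hpos : 0 < 2 ^ n := by positivity
  -- it suffices to bound `choose * l` when the binomial coefficient is even
  have heven (hk2 : ¬ 2 ^ m ∣ k) (h : (2 : ℤ) ^ s₂ a ∣ ((c * 2 ^ m).choose k : ℤ) * l) :
      (2 : ℤ) ^ s₂ a ∣ ((c * 2 ^ m).choose k : ℤ) * (l - t) := by
    rw [mul_sub]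
    refine dvd_sub h ((two_pow_dvd_two_mul_stirlingLin hn one_pos ha).trans ?_)
    exact mul_dvd_mul_right (by exact_mod_cast two_dvd_choose hk2) _
  have hnd : k ≤ b * 2 ^ (n + 1) → ¬ 2 ^ m ∣ k := fun h hd => by
    have := Nat.le_of_dvd hk hd
    omega
  rcases Nat.lt_or_ge k (b * 2 ^ (n + 1)) with hkB | hkB
  · refine heven (hnd hkB.le) ?_
    obtain ⟨b, rfl⟩ : ∃ b', b = b' + 1 := ⟨b - 1, by omega⟩
    rcases le_or_gt k ((2 * b + 1) * 2 ^ n) with hlow | hmid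
    · have : l = 0 := by
        refine stirlingLin_eq_zero_of_natDegree_lt (lt_of_le_of_lt natDegree_mul_le ?_)
        rw [natDegree_X_pow, natDegree_pow, show (X - 1 : ℤ[X]) = X - C 1 by simp,
          natDegree_X_sub_C, mul_one]
        rw [h2n, h2n']
        nlinarith
      rw [this, mul_zero]; exact dvd_zero _
    · obtain ⟨r, rfl⟩ := Nat.exists_eq_add_of_lt hmid
      rw [add_assoc] at *
      set r' := r + 1 with hr'
      have hr : r' < 2 ^ n := by nlinarith
      have hc := two_pow_dvd_choose (m := m) c (2 * b + 1) (by omega) hr (by omega)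
      rw [mul_comm (2 ^ n)] at hc
      have hc' : (2 : ℤ) ^ (2 + s₂ r') ∣ ((c * 2 ^ m).choose ((2 * b + 1) * 2 ^ n + r') : ℤ) := by
        have := (pow_dvd_pow 2 (show 2 + s₂ r' ≤ m - n + s₂ r' by omega)).trans hc
        exact_mod_cast this
      have h1 := two_pow_dvd_stirlingLin_mid b n a r'
      have h2 := two_pow_dvd_mul_stirlingLin_mul_X_sub_one_pow (Nat.lt_succ_self (2 ^ (n + 1) + a))
        (diffDvd_two_smul_eval_X_pow _ (n + 1)) r'
      -- The index 2^(n+1)+a has one more binary digit 1, hence one more factor 2 than needed.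
      rw [s₂_two_pow_add ha] at h2
      set l' := stirlingLin (2 ^ (n + 1) + a) (X ^ 2 ^ (n + 1) * (X - 1) ^ r')
      have h3 : (2 : ℤ) ^ s₂ a ∣ 2 ^ (2 + s₂ r') * (l - l') := by
        refine Dvd.dvd.trans ?_ (mul_dvd_mul_left _ h1)
        rw [← pow_add]
        exact pow_dvd_pow 2 (by omega)
      have h4 : (2 : ℤ) ^ s₂ a ∣ 2 ^ (2 + s₂ r') * l' := by
        refine ((pow_dvd_pow 2 (Nat.le_succ _)).trans h2).trans (mul_dvd_mul_right ?_ _)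
        exact pow_dvd_pow 2 (by omega)
      have h5 := dvd_add h3 h4
      rw [← mul_add, sub_add_cancel] at h5
      exact h5.trans (mul_dvd_mul_right hc' _)
  obtain ⟨i, rfl⟩ := Nat.exists_eq_add_of_le hkB
  have h1 : (2 : ℤ) ^ s₂ a ∣ l - stirlingLin a (X ^ 2 ^ n * (X - 1) ^ i) :=
    (pow_dvd_pow 2 hs).trans (two_pow_dvd_stirlingLin_high b n a i)
  have hi := Nat.div_add_mod i (2 ^ (n + 1))
  set i₀ := i % 2 ^ (n + 1) with hi₀
  set i₁ := i / 2 ^ (n + 1) with hi₁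
  have hlt : i₀ < 2 ^ (n + 1) := Nat.mod_lt _ (by positivity)
  rw [← hi] at h1
  rcases Nat.eq_zero_or_pos i₀ with h0 | h0
  · rcases Nat.eq_zero_or_pos i₁ with h0' | h0'
    · have hi0 : i = 0 := by rw [← hi, h0, h0', mul_zero]
      have hnd' := hnd (by omega)
      refine heven hnd' ?_
      have h2 := two_pow_dvd_mul_stirlingLin_X_pow_mul (r := 0) hn ha i₁
      rw [show 1 + s₂ 0 = 1 by simp [s₂], pow_one] at h2
      rw [h0] at h1
      have h3 := dvd_add (h1.mul_left 2) h2
      rw [← mul_add, sub_add_cancel] at h3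
      exact h3.trans (mul_dvd_mul_right (by exact_mod_cast two_dvd_choose hnd') _)
    · refine Dvd.dvd.mul_left ?_ _
      rw [h0, add_zero] at h1
      have := dvd_add h1 (two_pow_dvd_stirlingLin_pow_mul_pow_sub hn h0' one_pos ha)
      rwa [sub_add_sub_cancel] at this
  · have hk' : b * 2 ^ (n + 1) + i = 2 ^ (n + 1) * (b + i₁) + i₀ := by rw [← hi]; ring
    refine heven (fun hd => ?_) ?_
    · have h3 := (pow_dvd_pow 2 (show n + 1 ≤ m by omega)).trans hd
      rw [hk', Nat.dvd_add_right (Dvd.intro _ rfl)] at h3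
      exact absurd (Nat.le_of_dvd h0 h3) (by omega)
    · have hc := two_pow_dvd_choose (m := m) c (b + i₁) h0 hlt (by omega)
      rw [← hk'] at hc
      have hc' : (2 : ℤ) ^ (1 + s₂ i₀) ∣ ((c * 2 ^ m).choose (b * 2 ^ (n + 1) + i) : ℤ) := by
        have := (pow_dvd_pow 2 (show 1 + s₂ i₀ ≤ m - (n + 1) + s₂ i₀ by omega)).trans hc
        exact_mod_cast this
      have h3 := dvd_add (h1.mul_left (2 ^ (1 + s₂ i₀)))
        (two_pow_dvd_mul_stirlingLin_X_pow_mul (r := i₀) hn ha i₁)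
      rw [← mul_add, sub_add_cancel] at h3
      exact h3.trans (mul_dvd_mul_right hc' _)

theorem two_pow_dvd_stirlingSecond_add {a b c m n : ℕ} (hn : 0 < n) (ha1 : 1 ≤ a)
    (ha : a < 2 ^ (n + 1)) (hm : n + 2 ≤ m) (hb : 0 < b) (hbm : b * 2 ^ (n + 1) < 2 ^ m)
    (hc : 0 < c) :
    (2 : ℤ) ^ s₂ a ∣
      (Nat.stirlingSecond (c * 2 ^ m + b * 2 ^ (n + 1) + 2 ^ n) (b * 2 ^ (n + 2) + a) : ℤ)
        + stirlingLin a (X ^ 2 ^ n * (X - 1) ^ (2 ^ (n + 1) * 1)) := by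
  set t := stirlingLin a (X ^ 2 ^ n * (X - 1) ^ (2 ^ (n + 1) * 1)) with ht
  set l : ℕ → ℤ := fun k =>
    stirlingLin (b * 2 ^ (n + 2) + a) (X ^ (b * 2 ^ (n + 1) + 2 ^ n) * (X - 1) ^ k) with hl
  set M := c * 2 ^ m with hM
  have hMpos : 0 < M := by positivity
  have hexp : (X ^ (M + b * 2 ^ (n + 1) + 2 ^ n) : ℤ[X]) = ∑ k ∈ Finset.range (M + 1),
      (M.choose k : ℤ) • (X ^ (b * 2 ^ (n + 1) + 2 ^ n) * (X - 1) ^ k) := by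
    have h1 : (X ^ M : ℤ[X]) = ((X - 1) + 1) ^ M := by rw [sub_add_cancel]
    rw [add_assoc, pow_add, h1, add_pow, Finset.sum_mul]
    refine Finset.sum_congr rfl fun k _ => ?_
    rw [one_pow, mul_one, zsmul_eq_mul]
    push_cast
    ring
  have hS : (Nat.stirlingSecond (M + b * 2 ^ (n + 1) + 2 ^ n) (b * 2 ^ (n + 2) + a) : ℤ)
      = ∑ k ∈ Finset.range (M + 1), (M.choose k : ℤ) * l k := by
    rw [← stirlingLin_X_pow, hexp, map_sum]
    simp only [map_smul, smul_eq_mul, hl]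
  have hl0 : l 0 = 0 := by
    refine stirlingLin_eq_zero_of_natDegree_lt ?_
    rw [pow_zero, mul_one, natDegree_X_pow]
    have : 0 < 2 ^ n := by positivity
    have h2 : 2 ^ (n + 2) = 4 * 2 ^ n := by ring
    have h3 : 2 ^ (n + 1) = 2 * 2 ^ n := by ring
    rw [h2, h3]
    nlinarith
  have hsum : (∑ k ∈ Finset.range (M + 1), (M.choose k : ℤ)) = 2 ^ M := by
    exact_mod_cast Nat.sum_range_choose M
  -- The term k = 0 is exceptional: l 0 = 0 leaves -t, the source of the sign in S ≡ -t.
  have hsplit : ∑ k ∈ Finset.range (M + 1), (M.choose k : ℤ) * (l k - t)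
      = ∑ k ∈ Finset.range M, (M.choose (k + 1) : ℤ) * (l (k + 1) - t) - t := by
    rw [Finset.sum_range_succ', hl0]; simp [sub_eq_add_neg]
  have hdiff : ∑ k ∈ Finset.range (M + 1), (M.choose k : ℤ) * (l k - t)
      = ∑ k ∈ Finset.range (M + 1), (M.choose k : ℤ) * l k - 2 ^ M * t := by
    simp only [mul_sub, Finset.sum_sub_distrib, ← Finset.sum_mul, hsum]
  have h1 : (2 : ℤ) ^ s₂ a ∣ ∑ k ∈ Finset.range M, (M.choose (k + 1) : ℤ) * (l (k + 1) - t) :=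
    Finset.dvd_sum fun k _ =>
      two_pow_dvd_choose_mul_stirlingLin_sub hn ha1 ha hm hb hbm k.succ_pos
  have h2 : (2 : ℤ) ^ s₂ a ∣ 2 ^ M * t :=
    (two_pow_dvd_two_mul_stirlingLin hn one_pos ha).trans
      (mul_dvd_mul_right (dvd_pow_self 2 hMpos.ne') _)
  rw [hS, show ∑ k ∈ Finset.range (M + 1), (M.choose k : ℤ) * l k + t
    = ∑ k ∈ Finset.range M, (M.choose (k + 1) : ℤ) * (l (k + 1) - t) + 2 ^ M * t by linarith]
  exact dvd_add h1 h2

theorem theorem1p4 (a b c m n : ℕ) (hb : 0 < b) (hn : 0 < n)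
    (ha1 : 1 ≤ a) (ha2 : a < 2 ^ (n + 1)) (hm : n + 2 + ⌊Real.logb 2 (b : ℝ)⌋ ≤ (m : ℤ))
    (hc : Odd c) :
    Nat.stirlingSecond (c * 2 ^ m + b * 2 ^ (n + 1) + 2 ^ n) (b * 2 ^ (n + 2) + a) ≠ 0 ∧
    (a = 2 ^ (n + 1) - 1 →
      padicValNat 2
        (Nat.stirlingSecond (c * 2 ^ m + b * 2 ^ (n + 1) + 2 ^ n) (b * 2 ^ (n + 2) + a)) = n) ∧
    (a < 2 ^ (n + 1) - 1 →
      s₂ a ≤ padicValNat 2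
        (Nat.stirlingSecond (c * 2 ^ m + b * 2 ^ (n + 1) + 2 ^ n) (b * 2 ^ (n + 2) + a))) := by
  have hlog : n + 2 + Nat.log 2 b ≤ m := by
    have h1 : ⌊Real.logb 2 (b : ℝ)⌋ = Nat.log 2 b := by
      have := Real.floor_logb_natCast (b := 2) (r := (b : ℝ)) (by positivity)
      rw [Nat.cast_two] at this
      rw [this, Int.log_natCast]
    rw [h1] at hm
    exact_mod_cast hm
  have hcpos : 0 < c := hc.pos
  have hm2 : n + 2 ≤ m := by omega
  have hb2 : 2 * (b * 2 ^ (n + 1)) < 2 * 2 ^ m := by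
    have h1 : b < 2 ^ (Nat.log 2 b + 1) := Nat.lt_pow_succ_log_self (by norm_num) b
    have h2 : 2 ^ (Nat.log 2 b + 1) * 2 ^ (n + 1) ≤ 2 ^ m := by
      rw [← pow_add]; exact Nat.pow_le_pow_right (by norm_num) (by omega)
    have h3 : b * 2 ^ (n + 1) < 2 ^ (Nat.log 2 b + 1) * 2 ^ (n + 1) :=
      Nat.mul_lt_mul_of_pos_right h1 (by positivity)
    omega
  have hbm : b * 2 ^ (n + 1) < 2 ^ m := by omega
  have hKN : b * 2 ^ (n + 2) + a ≤ c * 2 ^ m + b * 2 ^ (n + 1) + 2 ^ n := by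
    have h1 : (b + 1) * 2 ^ (n + 1) ≤ 2 ^ m := by
      obtain ⟨q, hq⟩ : 2 ^ (n + 1) ∣ 2 ^ m := pow_dvd_pow 2 (by omega)
      rw [hq, mul_comm] at hbm ⊢
      exact Nat.mul_le_mul_left _ (Nat.lt_of_mul_lt_mul_left hbm)
    have h2 : 2 ^ m ≤ c * 2 ^ m := Nat.le_mul_of_pos_left _ hcpos
    have h3 : b * 2 ^ (n + 2) = 2 * (b * 2 ^ (n + 1)) := by ring
    rw [add_mul, one_mul] at h1
    omega
  have hpos := stirlingSecond_pos (by omega) hKN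
  have key := two_pow_dvd_stirlingSecond_add hn ha1 ha2 hm2 hb hbm hcpos
  set S := Nat.stirlingSecond (c * 2 ^ m + b * 2 ^ (n + 1) + 2 ^ n) (b * 2 ^ (n + 2) + a)
  have hiff : 2 ^ s₂ a ∣ S ↔ a ≠ 2 ^ (n + 1) - 1 := by
    rw [← two_pow_dvd_stirlingLin_iff_ne hn one_pos ha2, ← Int.natCast_dvd_natCast,
      Nat.cast_pow, Nat.cast_two]
    exact ⟨fun h => (dvd_add_right h).1 key, fun h => (dvd_add_left h).1 key⟩
  refine ⟨hpos.ne', fun h => ?_, fun h => ?_⟩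
  · have hs : s₂ a = n + 1 := by rw [h]; exact s₂_two_pow_sub_one (n + 1)
    have h2 : 2 ^ n ∣ S := by
      -- Here 2^(n+1) divides 2t, hence 2S, which gives the lower bound n.
      have h3 := (key.mul_left 2)
      rw [mul_add] at h3
      have h4 := (dvd_add_left (two_pow_dvd_two_mul_stirlingLin hn one_pos ha2)).1 h3
      rw [hs, pow_succ', mul_dvd_mul_iff_left two_ne_zero] at h4
      exact_mod_cast h4
    have h5 : ¬ 2 ^ (n + 1) ∣ S := by rw [← hs, hiff]; simpa using h
    refine le_antisymm ?_ ((padicValNat_dvd_iff_le hpos.ne').1 h2)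
    by_contra! hlt
    exact h5 ((padicValNat_dvd_iff_le hpos.ne').2 hlt)
  · exact (padicValNat_dvd_iff_le hpos.ne').1 (hiff.2 h.ne)
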